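/- Proposition 5.1 (non-constant). Let $K$ be a number field and let $X$ be a smooth projective (geometrically irreducible) curve over $K$, with group $\mathrm{Aut}_K(X)$ of automorphisms over $K$. Let $G$ and $H$ be finite subgroups of $\mathrm{Aut}_K(X)$ such that the quotient $X/H$ is an elliptic curve $E$ over $K$, let $f:X\to X/H=E$ be the quotient map, and let $\sigma\in G$. For $\tau\in\mathrm{Aut}_K(X)$ write $f\tau=f\circ\tau$; sums and differences of morphisms $X\to E$ are taken with respect to the group law of $E$. (a) Let $n\ge 1$ be an integer and let $G_1$ be the subgroup of $\mathrm{Aut}_K(X)$ generated by $H$ and $\bigcap_{i=1}^{n-1}\sigma^{-i}H\sigma^{i}$ (for $n=1$ the empty intersection is $\mathrm{Aut}_K(X)$). If the quotient $X/G_1$ is a smooth projective curve of genus $0$, then the morphism $f+f\sigma+\dots+f\sigma^{n-1}:X\to E$ is non-constant. (b) Let $G_2$ be the subgroup of $\mathrm{Aut}_K(X)$ generated by $\sigma$ and $H$. If the quotient $X/G_2$ is a smooth projective curve of genus $0$, then the morphism $f-f\sigma:X\to E$ is non-constant. -/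

import Mathlib

open CategoryTheory AlgebraicGeometry MonoidalCategory CartesianMonoidalCategory
open scoped MonObj Pointwise

universe u

noncomputable section

namespace QuotientCurve

variable {K : Type u} [Field K]

/-- A smooth projective curve over the field `K`: a proper, geometrically integral `K`-scheme,
smooth of relative dimension one. (A proper curve over a field is automatically projective.) -/
class IsCurve (X : Over (Spec (.of K))) : Prop where
  isProper : IsProper X.hom
  smooth : SmoothOfRelativeDimension 1 X.hom
  geometricallyIntegral : GeometricallyIntegral X.hom

instance (X : Over (Spec (.of K))) [h : IsCurve X] : IsProper X.hom := h.isProper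

instance (X : Over (Spec (.of K))) [h : IsCurve X] : SmoothOfRelativeDimension 1 X.hom := h.smooth

instance (X : Over (Spec (.of K))) [h : IsCurve X] : GeometricallyIntegral X.hom :=
  h.geometricallyIntegral

instance (X : Over (Spec (.of K))) [IsCurve X] : IsIntegral X.left :=
  haveI : Subsingleton (Spec (CommRingCat.of K)) :=
    inferInstanceAs (Subsingleton (PrimeSpectrum K))
  GeometricallyIntegral.isIntegral_of_subsingleton X.hom

/-! ### The genus

The genus of a curve `X` is the `K`-dimension of `H¹(X, 𝒪_X)`. Here `H¹` is given by its classical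
description by repartitions (Weil, Serre): the constant sheaf `F` of rational functions
is flasque, so the exact sequence `0 → 𝒪_X → F → F / 𝒪_X → 0` presents `H¹(X, 𝒪_X)` as
the quotient of the space of repartitions by the sum of the everywhere regular repartitions and
the constant ones. -/

section Genus

variable (X : Over (Spec (.of K))) [IsIntegral X.left]

/-- The ring homomorphism from the base field to the function field, given by the
structure morphism of `X`. -/
def constants : K →+* X.left.functionField :=
  (X.left.presheaf.germ ⊤ (genericPoint X.left) trivial).hom.comp
    (X.hom.appTop.hom.comp (Scheme.ΓSpecIso (.of K)).inv.hom)

instance : Algebra K X.left.functionField := (constants X).toAlgebra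

/-- The closed points of `X`. -/
abbrev ClosedPoint : Type u := {x : X.left // IsClosed ({x} : Set X.left)}

/-- The rational function `r` is regular at `x`: it comes from the local ring at `x`. -/
def IsRegularAt (x : X.left) (r : X.left.functionField) : Prop :=
  r ∈ (algebraMap (X.left.presheaf.stalk x) X.left.functionField).range

variable {X} in
lemma isRegularAt_constants (x : X.left) (c : K) : IsRegularAt X x (constants X c) := by
  have : Nonempty ((⊤ : X.left.Opens) : Type u) := ⟨⟨x, trivial⟩⟩
  exact ⟨X.left.presheaf.germ ⊤ x trivial
    (X.hom.appTop.hom ((Scheme.ΓSpecIso (.of K)).inv.hom c)),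
    Scheme.algebraMap_germ_eq_germToFunctionField (X := X.left) (U := ⊤) (x := x) trivial _⟩

variable {X} in
lemma IsRegularAt.smul {x : X.left} {r : X.left.functionField} (c : K) (h : IsRegularAt X x r) :
    IsRegularAt X x (c • r) := by
  rw [Algebra.smul_def]
  exact Subring.mul_mem _ (isRegularAt_constants x c) h

/-- Repartitions: families of rational functions indexed by the closed points, all but
finitely many of whose members are regular at their point. -/
def repartitions : Submodule K (ClosedPoint X → X.left.functionField) where
  carrier := {r | {x : ClosedPoint X | ¬ IsRegularAt X x.1 (r x)}.Finite}
  zero_mem' := by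
    exact Set.finite_empty.subset fun x hx => hx (Subring.zero_mem _)
  add_mem' := by
    intro r s hr hs
    refine (hr.union hs).subset fun x hx => ?_
    by_contra h
    simp only [Set.mem_union, Set.mem_ofPred_eq, not_or, not_not] at h
    exact hx (Subring.add_mem _ h.1 h.2)
  smul_mem' := by
    intro c r hr
    exact hr.subset fun x hx h => hx (h.smul c)

/-- The everywhere regular repartitions. -/
def regularRepartitions : Submodule K (ClosedPoint X → X.left.functionField) where
  carrier := {r | ∀ x : ClosedPoint X, IsRegularAt X x.1 (r x)}
  zero_mem' := fun _ => Subring.zero_mem _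
  add_mem' := fun hr hs x => Subring.add_mem _ (hr x) (hs x)
  smul_mem' := fun c _ hr x => (hr x).smul c

/-- The constant families of rational functions. (On a curve these are repartitions, as a rational
function has finitely many poles.) -/
def constantRepartitions : Submodule K (ClosedPoint X → X.left.functionField) where
  carrier := Set.range fun φ : X.left.functionField => fun _ : ClosedPoint X => φ
  zero_mem' := ⟨0, rfl⟩
  add_mem' := by
    rintro _ _ ⟨φ, rfl⟩ ⟨ψ, rfl⟩
    exact ⟨φ + ψ, rfl⟩
  smul_mem' := by
    rintro c _ ⟨φ, rfl⟩
    exact ⟨c • φ, rfl⟩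

/-- `H¹(X, 𝒪_X)`: repartitions modulo regular plus constant ones. -/
abbrev H1 : Type u :=
  repartitions X ⧸
    (regularRepartitions X ⊔ constantRepartitions X).comap (repartitions X).subtype

/-- `X` has genus `g`: the dimension of `H¹(X, 𝒪_X)` over `K`, as a cardinal, is `g`. -/
def HasGenus (g : ℕ) : Prop := Module.rank K (H1 X) = g

end Genus

/-- An elliptic curve over `K`: a smooth projective curve of genus one with a
group law over `K`, whose neutral element is the distinguished rational point. -/
class IsEllipticCurve (E : Over (Spec (.of K))) [GrpObj E] : Prop extends IsCurve E where
  genus_one : HasGenus E 1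

/-- The group law of an elliptic curve is commutative, so that the `K`-morphisms from any
`K`-scheme to it form a commutative group (written multiplicatively in Mathlib). -/
instance (E : Over (Spec (.of K))) [GrpObj E] [IsEllipticCurve E] : IsCommMonObj E :=
  isCommMonObj_of_isProper_of_geometricallyIntegral E

/-- `π : X ⟶ Y` is the quotient of `X` by the group `G` of automorphisms of `X` over `K`: it is
`G`-invariant, and each `G`-invariant morphism factors uniquely through it. -/
def IsQuotient {X Y : Over (Spec (.of K))} (G : Subgroup (Aut X)) (π : X ⟶ Y) : Prop :=
  (∀ g ∈ G, g.hom ≫ π = π) ∧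
    ∀ (Z : Over (Spec (.of K))) (ψ : X ⟶ Z), (∀ g ∈ G, g.hom ≫ ψ = ψ) →
      ∃! φ : Y ⟶ Z, π ≫ φ = ψ

/-- `X/G` (exists, is a smooth projective curve, and) has genus zero. -/
def QuotientHasGenusZero {X : Over (Spec (.of K))} (G : Subgroup (Aut X)) : Prop :=
  ∃ (Y : Over (Spec (.of K))) (_ : IsCurve Y) (π : X ⟶ Y), IsQuotient G π ∧ HasGenus Y 0

/-- A morphism over `K` is constant if it factors through a `K`-rational point of its target
(`𝟙_` is `Spec K`, and `toUnit X` the structure morphism of `X`). -/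
def IsConstant {X Z : Over (Spec (.of K))} (φ : X ⟶ Z) : Prop :=
  ∃ c : 𝟙_ (Over (Spec (.of K))) ⟶ Z, φ = toUnit X ≫ c

/-- `f ∘ σ`; the product in `Aut X` is composition of functions, so that `σ ↦ f ∘ σ` is
a right action. -/
abbrev precomp {X Z : Over (Spec (.of K))} (f : X ⟶ Z) (σ : Aut X) : X ⟶ Z := σ.hom ≫ f

/-- The sum `f + fσ + ⋯ + fσⁿ⁻¹` in the group of morphisms from `X` to `E`. -/
def orbitSum {X E : Over (Spec (.of K))} [GrpObj E] [IsEllipticCurve E]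
    (f : X ⟶ E) (σ : Aut X) (n : ℕ) : X ⟶ E :=
  ∏ i ∈ Finset.range n, precomp f (σ ^ i)

/-- The difference `f - fσ` in the group of morphisms from `X` to `E`. -/
def orbitDiff {X E : Over (Spec (.of K))} [GrpObj E] [IsEllipticCurve E]
    (f : X ⟶ E) (σ : Aut X) : X ⟶ E :=
  f / precomp f σ

/-- The subgroup `σ⁻ⁱ H σⁱ` of the automorphism group. -/
def conjPow {X : Over (Spec (.of K))} (H : Subgroup (Aut X)) (σ : Aut X) (i : ℕ) :
    Subgroup (Aut X) :=
  H.map (MulAut.conj (σ ^ i)⁻¹).toMonoidHom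

end QuotientCurve

end

/-!
Suppose first that `f + fσ + ⋯ + fσⁿ⁻¹` is constant. Then `f` is a constant minus the sum of the
`fσⁱ`, `1 ≤ i < n`, each of which is invariant under `σ⁻ⁱHσⁱ`; as `f` is invariant under `H`, it is
invariant under `G₁` and factors through `X/G₁`. Suppose next that `f - fσ` is a constant `c`, and
let `N` be the order of `σ`. Then `f = fσᴺ = f - Nc`, so that `Nc = 0` and `Nf` is invariant under
`σ` and `H`, hence factors through `X/G₂`. In both cases some positive multiple `nf` factors
through a curve `Y` of genus zero, and this is impossible (`not_le_invariantSubgroup_pow`):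

* A morphism `φ` from a curve `Y` of genus zero to an elliptic curve `E` is not dominant
  (`map_genericPoint_ne`). If it were, the function field of `Y` would be a finite extension of that
  of `E`. Write the pullback of a repartition of `E` as a regular repartition plus a rational
  function `g`. The local rings of `E` are integrally closed, so by the valuative criterion of
  properness (`isIntegralElem_of_forall_mem_range`) the trace maps functions which are regular
  on a fibre of `φ` to functions regular at its image. Dividing the trace by the degree, the given
  repartition is regular up to the trace of `g`, so `H¹(E, 𝒪_E)` would vanish
  (`subsingleton_H1_of_dominant`). That local rings are principal ideal domains and that function
  fields have transcendence degree one comes from étale coordinates (`exists_etale_mvPolynomial`).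
* Hence `φ` takes its values in an affine open set. By the universal property of the quotient `f`,
  multiplication by `n` on `E` factors through this affine open set, and it is constant since the
  global functions of `E` are (`pow_eq_one_of_factors`).
* Multiplication by `n` on `E` is multiplication by `n` on the tangent space at the neutral element
  (`IsCoordinate.pow`), which is nonzero, and the characteristic is zero (`id_pow_ne_one`).
-/

/-! ### Algebras étale over a polynomial ring in one variable -/

section Algebra

open IsLocalRing

/-- A local domain which is essentially of finite type and unramified over a principal ideal
domain is a principal ideal domain: its maximal ideal is generated by the image of a generator of
the prime ideal below it. -/
lemma isPrincipalIdealRing_of_formallyUnramified (P O : Type*) [CommRing P] [IsDomain P]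
    [IsPrincipalIdealRing P] [CommRing O] [IsDomain O] [IsLocalRing O] [Algebra P O]
    [Algebra.EssFiniteType P O] [Algebra.FormallyUnramified P O] : IsPrincipalIdealRing O := by
  have : IsNoetherianRing O := Algebra.EssFiniteType.isNoetherianRing P O
  let p : Ideal P := (maximalIdeal O).comap (algebraMap P O)
  have hp : ∀ y : p.primeCompl, IsUnit (algebraMap P O y) := fun y ↦ by
    by_contra h
    exact y.2 ((mem_maximalIdeal _).mpr h)
  let R := Localization.AtPrime p
  let φ : R →+* O := IsLocalization.lift (M := p.primeCompl) hp
  algebraize [φ]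
  have : IsScalarTower P R O := .of_algebraMap_eq fun x ↦ (IsLocalization.lift_eq hp x).symm
  have : IsLocalHom (algebraMap R O) := by
    refine ⟨fun a ha ↦ ?_⟩
    obtain ⟨x, s, rfl⟩ := IsLocalization.exists_mk'_eq p.primeCompl a
    refine (IsLocalization.AtPrime.isUnit_mk'_iff R p x s).mpr fun hx ↦ ?_
    have h1 : algebraMap R O (IsLocalization.mk' R x s) * algebraMap P O s = algebraMap P O x := by
      rw [IsScalarTower.algebraMap_apply P R O, ← map_mul, IsLocalization.mk'_spec,
        ← IsScalarTower.algebraMap_apply]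
    exact (mem_maximalIdeal _).mp hx (h1 ▸ ha.mul (hp s))
  have : Algebra.EssFiniteType R O := .of_comp P _ _
  have : Algebra.FormallyUnramified R O := .of_restrictScalars P _ _
  have hmax : (maximalIdeal O).IsPrincipal := by
    rw [← Algebra.FormallyUnramified.map_maximalIdeal (R := R) (S := O)]
    infer_instance
  exact ((tfae_of_isNoetherianRing_of_isLocalRing_of_isDomain (R := O)).out 0 4).mpr hmax

/-- A field which is essentially of finite type and unramified over a domain `P` containing a
field `k`, and contains `P`, has the transcendence degree of `P` over `k`. -/
lemma trdeg_eq_of_formallyUnramified (k P F : Type u) [Field k] [CommRing P] [IsDomain P]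
    [Field F] [Algebra k P] [Algebra k F] [Algebra P F] [IsScalarTower k P F] [FaithfulSMul P F]
    [Algebra.EssFiniteType P F] [Algebra.FormallyUnramified P F] :
    Algebra.trdeg k F = Algebra.trdeg k P := by
  let Q := FractionRing P
  let : Algebra Q F := FractionRing.liftAlgebra P F
  have : Algebra.EssFiniteType Q F := .of_comp P _ _
  have : Algebra.FormallyUnramified Q F := .of_restrictScalars P _ _
  have : Module.Finite Q F := Algebra.FormallyUnramified.finite_of_free _ _
  have : Algebra.IsAlgebraic P F :=
    (IsFractionRing.comap_isAlgebraic_iff (K := Q)).mpr inferInstance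
  rw [← trdeg_add_eq k P (A := F), trdeg_eq_zero (R := P), add_zero]

instance (k : Type*) [Field k] : IsPrincipalIdealRing (MvPolynomial (Fin 1) k) :=
  let e := MvPolynomial.uniqueAlgEquiv k (Fin 1)
  .of_surjective e.symm.toRingHom e.symm.surjective

end Algebra

noncomputable section

namespace QuotientCurve

variable {K : Type u} [Field K]

/-! ### Local structure of curves -/

section Curve

variable (X : Over (Spec (.of K)))

/-- The ring homomorphism from the base field to the sections over an open set. -/
def constantSections (V : X.left.Opens) : K →+* Γ(X.left, V) :=
  (X.left.presheaf.map (homOfLE le_top : V ⟶ ⊤).op).hom.comp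
    (X.hom.appTop.hom.comp (Scheme.ΓSpecIso (.of K)).inv.hom)

lemma algebraMap_functionField_eq [IsIntegral X.left] (V : X.left.Opens) [Nonempty V] :
    algebraMap K X.left.functionField =
      (algebraMap Γ(X.left, V) X.left.functionField).comp (constantSections X V) := by
  ext a
  change (X.left.presheaf.germ ⊤ (genericPoint X.left) trivial).hom _ =
    (X.left.presheaf.germ V (genericPoint X.left) _).hom ((X.left.presheaf.map _).hom _)
  rw [← CommRingCat.comp_apply, X.left.presheaf.germ_res]

lemma exists_isStandardSmooth_constantSections [SmoothOfRelativeDimension 1 X.hom] (x : X.left) :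
    ∃ V : X.left.Opens, IsAffineOpen V ∧ x ∈ V ∧
      (constantSections X V).IsStandardSmoothOfRelativeDimension 1 := by
  obtain ⟨U, hU, V, hV, hx, e, h⟩ :=
    SmoothOfRelativeDimension.exists_isStandardSmoothOfRelativeDimension (n := 1) (f := X.hom) x
  refine ⟨V, hV, hx, ?_⟩
  have hUtop : U = ⊤ := by
    have : Subsingleton (Spec (CommRingCat.of K)) :=
      inferInstanceAs (Subsingleton (PrimeSpectrum K))
    refine top_le_iff.mp fun y _ ↦ ?_
    exact Subsingleton.elim (X.hom x) y ▸ e hx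
  subst hUtop
  exact RingHom.IsStandardSmoothOfRelativeDimension.comp h
    (.equiv (Scheme.ΓSpecIso (.of K)).symm.commRingCatIsoToRingEquiv)

/-- Étale coordinates: near each point, a curve is étale over the affine line. -/
lemma exists_etale_mvPolynomial [SmoothOfRelativeDimension 1 X.hom] (x : X.left) :
    ∃ V : X.left.Opens, IsAffineOpen V ∧ x ∈ V ∧
      ∃ g : MvPolynomial (Fin 1) K →+* Γ(X.left, V),
        g.comp MvPolynomial.C = constantSections X V ∧ g.Etale := by
  obtain ⟨V, hV, hx, h⟩ := exists_isStandardSmooth_constantSections X x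
  exact ⟨V, hV, hx, h.exists_etale_mvPolynomial⟩

variable [IsIntegral X.left] [SmoothOfRelativeDimension 1 X.hom]

/-- The local rings of a curve are principal ideal domains, that is, fields or discrete valuation
rings. -/
instance isPrincipalIdealRing_stalk (x : X.left) :
    IsPrincipalIdealRing (X.left.presheaf.stalk x) := by
  obtain ⟨V, hV, hx, g, -, hg⟩ := exists_etale_mvPolynomial X x
  let P := MvPolynomial (Fin 1) K
  let O := X.left.presheaf.stalk x
  have : Nonempty V := ⟨⟨x, hx⟩⟩
  let : Algebra Γ(X.left, V) O := (X.left.presheaf.germ V x hx).hom.toAlgebra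
  algebraize [g]
  let : Algebra P O := ((algebraMap Γ(X.left, V) O).comp g).toAlgebra
  have : IsScalarTower P Γ(X.left, V) O := .of_algebraMap_eq' rfl
  have : IsLocalization.AtPrime O (hV.primeIdealOf ⟨x, hx⟩).asIdeal :=
    hV.isLocalization_stalk ⟨x, hx⟩
  have : Algebra.FormallyUnramified Γ(X.left, V) O :=
    .of_isLocalization (hV.primeIdealOf ⟨x, hx⟩).asIdeal.primeCompl
  have : Algebra.EssFiniteType Γ(X.left, V) O :=
    .of_isLocalization _ (hV.primeIdealOf ⟨x, hx⟩).asIdeal.primeCompl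
  have : Algebra.FormallyUnramified P O := .comp _ Γ(X.left, V) _
  have : Algebra.EssFiniteType P O := .comp _ Γ(X.left, V) _
  exact isPrincipalIdealRing_of_formallyUnramified P O

lemma trdeg_functionField_and_essFiniteType :
    Algebra.trdeg K X.left.functionField = 1 ∧ Algebra.EssFiniteType K X.left.functionField := by
  obtain ⟨V, hV, hx, g, hgC, hg⟩ := exists_etale_mvPolynomial X (genericPoint X.left)
  let P := MvPolynomial (Fin 1) K
  let F := X.left.functionField
  have : Nonempty V := ⟨⟨_, hx⟩⟩
  have : IsFractionRing Γ(X.left, V) F := functionField_isFractionRing_of_isAffineOpen _ V hV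
  algebraize [g]
  let : Algebra P F := ((algebraMap Γ(X.left, V) F).comp g).toAlgebra
  have : IsScalarTower P Γ(X.left, V) F := .of_algebraMap_eq' rfl
  have : IsScalarTower K P F := .of_algebraMap_eq' <| by
    rw [algebraMap_functionField_eq X V, ← hgC]
    rfl
  have : FaithfulSMul P F := by
    have : FaithfulSMul P Γ(X.left, V) := inferInstance
    exact .trans P Γ(X.left, V) F
  have : Algebra.FormallyUnramified Γ(X.left, V) F :=
    .of_isLocalization (nonZeroDivisors Γ(X.left, V))
  have : Algebra.EssFiniteType Γ(X.left, V) F :=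
    .of_isLocalization _ (nonZeroDivisors Γ(X.left, V))
  have : Algebra.FormallyUnramified P F := .comp _ Γ(X.left, V) _
  have : Algebra.EssFiniteType P F := .comp _ Γ(X.left, V) _
  refine ⟨?_, .comp K P F⟩
  rw [trdeg_eq_of_formallyUnramified K P F, MvPolynomial.trdeg_of_isDomain]
  simp

/-- The function field of a curve has transcendence degree one. -/
lemma trdeg_functionField : Algebra.trdeg K X.left.functionField = 1 :=
  (trdeg_functionField_and_essFiniteType X).1

instance essFiniteType_functionField : Algebra.EssFiniteType K X.left.functionField :=
  (trdeg_functionField_and_essFiniteType X).2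

end Curve

/-! ### Points and rational functions on a curve -/

section Topology

variable (X : Over (Spec (.of K))) [IsIntegral X.left] [SmoothOfRelativeDimension 1 X.hom]

/-- Curves have dimension at most one: the nonzero prime ideals of their local rings are maximal. -/
lemma isClosed_singleton_of_ne_genericPoint {x : X.left} (hx : x ≠ genericPoint X.left) :
    IsClosed {x} := by
  refine closure_subset_iff_isClosed.mp fun y hy ↦ ?_
  have hxy : x ⤳ y := specializes_iff_mem_closure.mpr hy
  obtain ⟨p, hp⟩ : x ∈ Set.range (X.left.fromSpecStalk y) := by
    rw [Scheme.range_fromSpecStalk]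
    exact hxy
  obtain ⟨q, hq⟩ : genericPoint X.left ∈ Set.range (X.left.fromSpecStalk y) := by
    rw [Scheme.range_fromSpecStalk]
    exact (genericPoint_spec X.left).specializes trivial
  have hp0 : p.asIdeal ≠ ⊥ := fun h ↦ by
    have hpq : p ⤳ q := (PrimeSpectrum.le_iff_specializes p q).mp (h.trans_le bot_le)
    have hxη := hpq.map (X.left.fromSpecStalk y).continuous
    rw [hp, hq] at hxη
    exact hx (hxη.antisymm ((genericPoint_spec X.left).specializes trivial)).eq
  have hpm : p = IsLocalRing.closedPoint (X.left.presheaf.stalk y) :=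
    PrimeSpectrum.ext (IsLocalRing.eq_maximalIdeal (p.isPrime.isMaximal hp0))
  rw [← hp, hpm, Scheme.fromSpecStalk_closedPoint]
  rfl

lemma finite_of_isClosed_of_genericPoint_notMem [IsProper X.hom] {Z : Set X.left}
    (hZ : IsClosed Z) (h : genericPoint X.left ∉ Z) : Z.Finite := by
  have := LocallyOfFiniteType.isLocallyNoetherian X.hom
  have : CompactSpace X.left := (quasiCompact_iff_compactSpace X.hom).mp inferInstance
  have : IsNoetherian X.left := {}
  obtain ⟨S, hS, hcl, hirr, rfl⟩ :=
    TopologicalSpace.NoetherianSpace.exists_finite_set_isClosed_irreducible hZ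
  refine hS.sUnion fun T hT ↦ ?_
  obtain ⟨z, hz⟩ := QuasiSober.sober (hirr T hT) (hcl T hT)
  have hzη : z ≠ genericPoint X.left := fun hzη ↦ h ⟨T, hT, hzη ▸ hz.mem⟩
  rw [← hz.def, (isClosed_singleton_of_ne_genericPoint X hzη).closure_eq]
  exact Set.finite_singleton z

end Topology

section FunctionFieldMap

variable {X Y : Scheme.{u}} [IsIntegral X] [IsIntegral Y] (f : X ⟶ Y)
  (hf : f (genericPoint X) = genericPoint Y)

/-- The embedding of function fields induced by a dominant morphism of integral schemes. -/
def functionFieldMap : Y.functionField ⟶ X.functionField :=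
  Y.presheaf.stalkSpecializes (specializes_of_eq hf) ≫ f.stalkMap (genericPoint X)

lemma stalkMap_comp_algebraMap (x : X) (a : Y.presheaf.stalk (f x)) :
    algebraMap (X.presheaf.stalk x) X.functionField ((f.stalkMap x).hom a) =
      (functionFieldMap f hf).hom (algebraMap (Y.presheaf.stalk (f x)) Y.functionField a) := by
  have h := f.stalkSpecializes_stalkMap (genericPoint X) x
    ((genericPoint_spec X).specializes trivial)
  have h' := TopCat.Presheaf.stalkSpecializes_comp Y.presheaf (specializes_of_eq hf)
    ((genericPoint_spec Y).specializes (trivial : f x ∈ _))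
  change (f.stalkMap x ≫ X.presheaf.stalkSpecializes _).hom a =
    (Y.presheaf.stalkSpecializes _ ≫ functionFieldMap f hf).hom a
  rw [← h, functionFieldMap, reassoc_of% h']

lemma functionFieldMap_germToFunctionField (s : Γ(Y, ⊤)) :
    (functionFieldMap f hf).hom ((Y.presheaf.germ ⊤ (genericPoint Y) trivial).hom s) =
      (X.presheaf.germ ⊤ (genericPoint X) trivial).hom (f.appTop.hom s) := by
  have h : Y.presheaf.germ ⊤ (genericPoint Y) trivial ≫ functionFieldMap f hf =
      f.appTop ≫ X.presheaf.germ ⊤ (genericPoint X) trivial := by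
    have h' := TopCat.Presheaf.germ_stalkSpecializes Y.presheaf (U := ⊤)
      (y := genericPoint Y) trivial (specializes_of_eq hf)
    rw [functionFieldMap, reassoc_of% h', Scheme.Hom.germ_stalkMap]
    rfl
  exact congr($(h).hom s)

/-- Let `f : X ⟶ Y` be universally closed and dominant. If a rational function `z` on `X` is regular
at all points whose image specializes to `y`, then `z` is integral over the local ring at `y`:
by the valuative criterion, every valuation ring of the function field of `X` which contains the
local ring at `y` contains the local ring of `X` at such a point. -/
lemma isIntegralElem_of_forall_mem_range [UniversallyClosed f] (y : Y) (z : X.functionField)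
    (hz : ∀ x : X, f x ⤳ y → z ∈ (algebraMap (X.presheaf.stalk x) X.functionField).range) :
    ((functionFieldMap f hf).hom.comp
      (algebraMap (Y.presheaf.stalk y) Y.functionField)).IsIntegralElem z := by
  let φ := (functionFieldMap f hf).hom.comp (algebraMap (Y.presheaf.stalk y) Y.functionField)
  suffices h : z ∈ (integralClosure (Subring.closure (φ.range : Set X.functionField))
      X.functionField).toSubring by
    rw [Subring.closure_eq] at h
    let : Algebra (Y.presheaf.stalk y) X.functionField := φ.toAlgebra
    let : Algebra (Y.presheaf.stalk y) φ.range := φ.rangeRestrict.toAlgebra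
    have : IsScalarTower (Y.presheaf.stalk y) φ.range X.functionField := .of_algebraMap_eq' rfl
    have : Algebra.IsIntegral (Y.presheaf.stalk y) φ.range :=
      ⟨φ.rangeRestrict.isIntegral_of_surjective φ.rangeRestrict_surjective⟩
    exact isIntegral_trans (R := Y.presheaf.stalk y) (A := φ.range) z h
  rw [← iInf_valuationSubring_superset, Subring.mem_iInf]
  rintro ⟨V, hV⟩
  let ψ : Y.presheaf.stalk y ⟶ .of V := 
    CommRingCat.ofHom (φ.codRestrict V.toSubring fun a ↦ hV ⟨a, rfl⟩)
  have hsq : X.fromSpecStalk (genericPoint X) ≫ f =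
      Spec.map (CommRingCat.ofHom (algebraMap V X.functionField)) ≫
        Spec.map ψ ≫ Y.fromSpecStalk y := by
    have h := Scheme.SpecMap_stalkSpecializes_fromSpecStalk
      ((genericPoint_spec Y).specializes (trivial : y ∈ _))
    rw [← Scheme.SpecMap_stalkMap_fromSpecStalk,
      ← Scheme.SpecMap_stalkSpecializes_fromSpecStalk (specializes_of_eq hf), ← h,
      ← Spec.map_comp_assoc, ← Spec.map_comp_assoc, ← Spec.map_comp_assoc]
    rfl
  have hex : ValuativeCriterion.Existence f := by
    have : UniversallyClosed f := inferInstance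
    rw [UniversallyClosed.eq_valuativeCriterion] at this
    exact this.1
  obtain ⟨l, hl₁, hl₂⟩ := (hex { R := V, K := X.functionField, commSq := ⟨hsq⟩, .. }).exists_lift
  let x : X := l (IsLocalRing.closedPoint V)
  have hx : f x ⤳ y := by
    have h : (l ≫ f) (IsLocalRing.closedPoint V) ∈ Set.range (Y.fromSpecStalk y) := by
      rw [hl₂]
      exact ⟨Spec.map ψ (IsLocalRing.closedPoint V), rfl⟩
    rwa [Scheme.range_fromSpecStalk] at h
  obtain ⟨a, rfl⟩ := hz x hx
  have key : Scheme.stalkClosedPointTo l ≫ CommRingCat.ofHom (algebraMap V X.functionField) =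
      X.presheaf.stalkSpecializes ((genericPoint_spec X).specializes (trivial : x ∈ _)) := by
    apply Spec.map_injective
    rw [← cancel_mono (X.fromSpecStalk _), Scheme.SpecMap_stalkSpecializes_fromSpecStalk,
      Spec.map_comp, Category.assoc, Scheme.Spec_stalkClosedPointTo_fromSpecStalk]
    exact hl₁
  have := ((Scheme.stalkClosedPointTo l).hom a).2
  have key' := congr($(key).hom a)
  change _ = algebraMap (X.presheaf.stalk x) X.functionField a at key'
  rw [← key']
  exact this

end FunctionFieldMap

/-! ### Curves dominated by a curve of genus zero -/

section GenusZero

variable {Y E : Over (Spec (.of K))} [IsCurve Y] [IsCurve E]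

/-- A morphism between curves is proper. -/
instance isProper_left (φ : Y ⟶ E) : IsProper φ.left := by
  have : IsProper (φ.left ≫ E.hom) := by rw [Over.w]; infer_instance
  exact .of_comp _ E.hom

/-- Regularity at the generic point is no condition. -/
lemma isRegularAt_genericPoint (X : Over (Spec (.of K))) [IsIntegral X.left]
    (r : X.left.functionField) : IsRegularAt X (genericPoint X.left) r :=
  ⟨r, congr($(X.left.presheaf.stalkSpecializes_refl (genericPoint X.left)).hom r)⟩

lemma functionFieldMap_constants (φ : Y ⟶ E)
    (hφ : φ.left (genericPoint Y.left) = genericPoint E.left) :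
    (functionFieldMap φ.left hφ).hom.comp (constants E) = constants Y := by
  ext a
  change (functionFieldMap φ.left hφ).hom ((E.left.presheaf.germ ⊤ _ trivial).hom _) =
    (Y.left.presheaf.germ ⊤ _ trivial).hom _
  have h : Y.hom.appTop = E.hom.appTop ≫ φ.left.appTop := by
    rw [← Scheme.Hom.comp_appTop, Over.w]
  rw [functionFieldMap_germToFunctionField, h]
  rfl

/-- A dominant morphism of curves induces a finite extension of function fields, since both have
transcendence degree one over `K`. -/
lemma finite_functionFieldMap (φ : Y ⟶ E)
    (hφ : φ.left (genericPoint Y.left) = genericPoint E.left) :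
    (functionFieldMap φ.left hφ).hom.Finite := by
  let F := E.left.functionField
  let L := Y.left.functionField
  let : Algebra F L := (functionFieldMap φ.left hφ).hom.toAlgebra
  have : IsScalarTower K F L := .of_algebraMap_eq' (functionFieldMap_constants φ hφ).symm
  have : Algebra.EssFiniteType F L := .of_comp K F L
  have h := trdeg_add_eq K F (A := L)
  rw [trdeg_functionField, trdeg_functionField] at h
  have : Algebra.IsAlgebraic F L := trdeg_eq_zero_iff.mp <|
    Cardinal.eq_of_add_eq_add_left (h.trans (add_zero 1).symm) Cardinal.one_lt_aleph0
  exact Algebra.finite_of_essFiniteType_of_isAlgebraic (F := F) (E := L)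

lemma isClosed_singleton_map (φ : Y ⟶ E) (y : ClosedPoint Y) : IsClosed {φ.left y.1} := by
  simpa using φ.left.isClosedMap _ y.2

/-- The pullback along a dominant morphism `φ` of a family of rational functions on `E`: its member
at `y` is the pullback of the member at `φ y`. -/
def pullbackRepartition (φ : Y ⟶ E) (hφ : φ.left (genericPoint Y.left) = genericPoint E.left)
    (r : ClosedPoint E → E.left.functionField) : ClosedPoint Y → Y.left.functionField :=
  fun y ↦ (functionFieldMap φ.left hφ).hom (r ⟨φ.left y.1, isClosed_singleton_map φ y⟩)

/-- The pullback of a repartition has finitely many poles, because proper closed subsets of a curve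
are finite. -/
lemma pullbackRepartition_mem (φ : Y ⟶ E)
    (hφ : φ.left (genericPoint Y.left) = genericPoint E.left)
    {r : ClosedPoint E → E.left.functionField} (hr : r ∈ repartitions E) :
    pullbackRepartition φ hφ r ∈ repartitions Y := by
  have hfin : (⋃ x ∈ {x : ClosedPoint E | ¬ IsRegularAt E x.1 (r x)}, φ.left ⁻¹' {x.1}).Finite := by
    refine Set.Finite.biUnion hr fun x hx ↦ finite_of_isClosed_of_genericPoint_notMem Y
      (x.2.preimage φ.left.continuous) fun h ↦ hx ?_
    have h' : x.1 = genericPoint E.left := (h : φ.left _ = x.1).symm.trans hφ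
    rw [h']
    exact isRegularAt_genericPoint E _
  refine (hfin.preimage Subtype.val_injective.injOn).subset fun y hy ↦ ?_
  refine Set.mem_biUnion (x := ⟨φ.left y.1, isClosed_singleton_map φ y⟩) (fun hreg ↦ hy ?_)
    (Set.mem_singleton _)
  obtain ⟨a, ha⟩ := hreg
  exact ⟨(φ.left.stalkMap y.1).hom a,
    (stalkMap_comp_algebraMap φ.left hφ y.1 a).trans congr((functionFieldMap φ.left hφ).hom $ha)⟩

/-- In characteristic zero, the first cohomology of the structure sheaf of a curve vanishes if
the curve is dominated by a curve of genus zero: the trace of function fields, divided by the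
degree, is a retraction of the pullback of repartitions. -/
lemma subsingleton_H1_of_dominant [CharZero K] (φ : Y ⟶ E)
    (hφ : φ.left (genericPoint Y.left) = genericPoint E.left) (hY : HasGenus Y 0) :
    Subsingleton (H1 E) := by
  have hY : Subsingleton (H1 Y) := by
    rw [HasGenus, Nat.cast_zero] at hY
    exact rank_zero_iff.mp hY
  rw [Submodule.Quotient.subsingleton_iff, eq_top_iff] at hY ⊢
  rintro ⟨r, hr⟩ -
  have hmem := hY (Submodule.mem_top (x := ⟨_, pullbackRepartition_mem φ hφ hr⟩))
  obtain ⟨s, hs, _, ⟨g, rfl⟩, hsg⟩ := Submodule.mem_sup.mp hmem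
  let F := E.left.functionField
  let L := Y.left.functionField
  let : Algebra F L := (functionFieldMap φ.left hφ).hom.toAlgebra
  have : Module.Finite F L := finite_functionFieldMap φ hφ
  let d := Module.finrank F L
  have hd : (d : K) ≠ 0 := Nat.cast_ne_zero.mpr Module.finrank_pos.ne'
  -- `r x - g` is regular on the fibre over `x`, where it agrees with `s`; hence it is integral over
  -- the local ring at `x`, and so is its trace.
  have hreg (x : ClosedPoint E) : IsRegularAt E x.1 (d • r x - Algebra.trace F L g) := by
    let O := E.left.presheaf.stalk x.1
    let : Algebra O L := ((algebraMap F L).comp (algebraMap O F)).toAlgebra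
    have : IsScalarTower O F L := .of_algebraMap_eq' rfl
    have hint : IsIntegral O (algebraMap F L (r x) - g) := by
      refine isIntegralElem_of_forall_mem_range φ.left hφ x.1 _ fun y hy ↦ ?_
      by_cases hyη : y = genericPoint Y.left
      · subst hyη
        exact isRegularAt_genericPoint Y _
      · have hyc := isClosed_singleton_of_ne_genericPoint Y hyη
        have hyx : φ.left y = x.1 := by
          have h := specializes_iff_mem_closure.mp hy
          rw [(isClosed_singleton_map φ ⟨y, hyc⟩).closure_eq] at h
          exact h.symm
        have h := congrFun hsg ⟨y, hyc⟩
        have hs' := hs ⟨y, hyc⟩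
        obtain ⟨x, hx⟩ := x
        subst hyx
        have : algebraMap F L (r ⟨φ.left y, hx⟩) - g = s ⟨y, hyc⟩ :=
          sub_eq_of_eq_add h.symm
        rw [this]
        exact hs'
    have htr := Algebra.isIntegral_trace (L := F) hint
    rw [map_sub, Algebra.trace_algebraMap] at htr
    exact IsIntegrallyClosed.isIntegral_iff.mp htr
  refine Submodule.mem_sup.mpr ⟨r - fun _ ↦ (d : K)⁻¹ • Algebra.trace F L g, fun x ↦ ?_,
    fun _ ↦ (d : K)⁻¹ • Algebra.trace F L g, ⟨_, rfl⟩, sub_add_cancel _ _⟩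
  have := (hreg x).smul (d : K)⁻¹
  rwa [smul_sub, ← Nat.cast_smul_eq_nsmul K, inv_smul_smul₀ hd] at this

/-- A morphism from a curve of genus zero to a curve of genus one is not dominant. -/
lemma map_genericPoint_ne [CharZero K] (φ : Y ⟶ E) (hY : HasGenus Y 0) (hE : HasGenus E 1) :
    φ.left (genericPoint Y.left) ≠ genericPoint E.left := fun hφ ↦ by
  have := subsingleton_H1_of_dominant φ hφ hY
  rw [HasGenus, rank_zero_iff.mpr this] at hE
  simp at hE

end GenusZero

/-! ### Morphisms with values in an affine open set -/

section Constant

/-- A morphism from a curve of genus zero to a curve of genus one takes a single value, a closed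
point, and in particular takes its values in an affine open set. -/
lemma exists_isAffineOpen_of_genus_zero [CharZero K] {Y E : Over (Spec (.of K))} [IsCurve Y]
    [IsCurve E] (φ : Y ⟶ E) (hY : HasGenus Y 0) (hE : HasGenus E 1) :
    ∃ U : E.left.Opens, IsAffineOpen U ∧ ∀ y, φ.left y ∈ U := by
  have hcl := isClosed_singleton_of_ne_genericPoint E (map_genericPoint_ne φ hY hE)
  obtain ⟨_, ⟨U, hU, rfl⟩, hxU, -⟩ := E.left.isBasis_affineOpens.exists_subset_of_mem_open
    (Set.mem_univ (φ.left (genericPoint Y.left))) isOpen_univ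
  refine ⟨U, hU, fun y ↦ ?_⟩
  have h : φ.left (genericPoint Y.left) ⤳ φ.left y :=
    ((genericPoint_spec Y.left).specializes trivial).map φ.left.continuous
  rw [specializes_iff_mem_closure, hcl.closure_eq] at h
  rwa [h]

/-- A morphism from a proper integral scheme with a rational point to an affine scheme is
constant. -/
lemma eq_toUnit_comp_of_isAffine {E Z : Over (Spec (.of K))} [IsProper E.hom] [IsIntegral E.left]
    [IsAffine Z.left] (e : 𝟙_ (Over (Spec (.of K))) ⟶ E) (α : E ⟶ Z) :
    α = toUnit E ≫ e ≫ α := by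
  let := (isField_of_universallyClosed K E.hom).toField
  have : Nontrivial Γ((𝟙_ (Over (Spec (.of K)))).left, ⊤) :=
    inferInstanceAs (Nontrivial Γ(Spec (.of K), ⊤))
  -- `Γ(E, ⊤)` is a field with a `K`-algebra homomorphism to `K`, hence equal to `K`
  have hinj : Function.Injective e.left.appTop.hom := e.left.appTop.hom.injective
  have h1 : (toUnit E).left.appTop ≫ e.left.appTop = 𝟙 _ := by
    rw [← Scheme.Hom.comp_appTop, ← Over.comp_left, toUnit_unique (e ≫ toUnit E) (𝟙 _),
      Over.id_left, Scheme.Hom.id_appTop]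
  have h2 : e.left.appTop ≫ (toUnit E).left.appTop = 𝟙 _ := by
    ext a
    exact hinj congr($(h1).hom (e.left.appTop.hom a))
  refine Over.OverMorphism.ext (ext_of_isAffine ?_)
  rw [Over.comp_left, Over.comp_left, Scheme.Hom.comp_appTop, Scheme.Hom.comp_appTop,
    Category.assoc, h2, Category.comp_id]

/-- A morphism `α` from a quotient `E` of `X` factors through an open subscheme `U` as soon as the
points of `X` are mapped to `U`, whether or not the quotient map is known to be surjective. -/
lemma IsQuotient.exists_comp_openImmersion_eq {X E Z U : Over (Spec (.of K))}
    {H : Subgroup (Aut X)} {f : X ⟶ E} (hf : IsQuotient H f) (α : E ⟶ Z) (j : U ⟶ Z) [IsOpenImmersion j.left]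
    (h : ∀ x, (f ≫ α).left x ∈ Set.range j.left) : ∃ β : E ⟶ U, β ≫ j = α := by
  have hfac := IsOpenImmersion.lift_fac j.left (f ≫ α).left (Set.range_subset_iff.mpr h)
  let a : X ⟶ U := Over.homMk (IsOpenImmersion.lift j.left (f ≫ α).left
    (Set.range_subset_iff.mpr h)) (by rw [← Over.w j, reassoc_of% hfac, Over.w])
  have ha : a ≫ j = f ≫ α := by
    ext1
    exact hfac
  have hj : Mono j := Over.mono_of_mono_left j
  have hinv {ψ : E ⟶ Z} (g : Aut X) (hg : g ∈ H) : g.hom ≫ f ≫ ψ = f ≫ ψ := by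
    rw [← Category.assoc, hf.1 g hg]
  obtain ⟨β, hβ, -⟩ := hf.2 U a fun g hg ↦ by
    rw [← cancel_mono j, Category.assoc, ha, hinv g hg]
  refine ⟨β, (hf.2 Z (f ≫ α) fun g hg ↦ hinv g hg).unique ?_ rfl⟩
  rw [← Category.assoc, hβ, ha]

/-- If a power of the quotient morphism `f : X ⟶ E` factors through a curve of genus zero, then the
corresponding multiplication map of `E` is trivial. -/
lemma pow_eq_one_of_factors [CharZero K] {X Y E : Over (Spec (.of K))} [IsCurve Y] [GrpObj E]
    [IsEllipticCurve E] {H : Subgroup (Aut X)} {f : X ⟶ E} (hf : IsQuotient H f)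
    (hY : HasGenus Y 0) (n : ℕ) (π : X ⟶ Y) (φ : Y ⟶ E) (h : f ^ n = π ≫ φ) :
    (𝟙 E) ^ n = 1 := by
  obtain ⟨U, hU, hφU⟩ := exists_isAffineOpen_of_genus_zero φ hY IsEllipticCurve.genus_one
  let j : Over.mk (U.ι ≫ E.hom) ⟶ E := Over.homMk U.ι
  have : IsOpenImmersion j.left := inferInstanceAs (IsOpenImmersion U.ι)
  have : IsAffine (Over.mk (U.ι ≫ E.hom)).left := hU
  obtain ⟨β, hβ⟩ := hf.exists_comp_openImmersion_eq (𝟙 E ^ n) j fun x ↦ by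
    rw [MonObj.comp_pow, Category.comp_id, h]
    change _ ∈ Set.range U.ι
    rw [Scheme.Opens.range_ι]
    exact hφU _
  rw [← hβ, eq_toUnit_comp_of_isAffine η[E] β, Category.assoc, Category.assoc, hβ,
    MonObj.comp_pow, Category.comp_id, MonObj.one_eq_one, one_pow, MonObj.comp_one]

end Constant

/-! ### Dual numbers and infinitesimal schemes -/

section TangentVectors

/-- If the kernel of a `K`-point `χ` of a `K`-algebra is not idempotent, there is a nonzero tangent
vector at `χ`. -/
lemma exists_algHom_dualNumber {A : Type u} [CommRing A] [Algebra K A] (χ : A →ₐ[K] K)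
    (h : ¬ IsIdempotentElem (RingHom.ker χ)) :
    ∃ ρ : A →ₐ[K] TrivSqZeroExt K K, (∀ a, (ρ a).fst = χ a) ∧ ∃ a, (ρ a).snd ≠ 0 := by
  let q : Ideal A := RingHom.ker χ
  obtain ⟨v, hv, hv2⟩ : ∃ v ∈ q, v ∉ q * q := by
    by_contra! hq
    exact h (le_antisymm Ideal.mul_le_left hq)
  have hv0 : q.toCotangent ⟨v, hv⟩ ≠ 0 := fun h0 ↦
    hv2 (pow_two q ▸ (q.toCotangent_eq_zero _).mp h0)
  obtain ⟨l, hl⟩ := not_forall.mp ((Module.forall_dual_apply_eq_zero_iff K _).not.mpr hv0)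
  let p : A →ₗ[K] q := LinearMap.codRestrict (q.restrictScalars K)
    (LinearMap.id - (Algebra.linearMap K A).comp χ.toLinearMap) fun a ↦ by simp [q, RingHom.mem_ker]
  have hp (a : A) : (p a : A) = a - algebraMap K A (χ a) := rfl
  let D : A →ₗ[K] K := l ∘ₗ (q.toCotangent.restrictScalars K) ∘ₗ p
  have hD (a b : A) : D (a * b) = χ a * D b + χ b * D a := by
    have : q.toCotangent (p (a * b)) = χ a • q.toCotangent (p b) + χ b • q.toCotangent (p a) := by
      rw [← algebraMap_smul A (χ a), ← algebraMap_smul A (χ b),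
        ← map_smul q.toCotangent, ← map_smul q.toCotangent, ← map_add,
        Ideal.toCotangent_eq]
      have : ((p (a * b) : A) - (algebraMap K A (χ a) • p b + algebraMap K A (χ b) • p a : q)) =
          p a * p b := by
        simp only [hp, Submodule.coe_add, Submodule.coe_smul, smul_eq_mul, map_mul]
        ring
      rw [this, pow_two]
      exact Ideal.mul_mem_mul (p a).2 (p b).2
    change l (q.toCotangent (p (a * b))) = χ a * l (q.toCotangent (p b)) +
      χ b * l (q.toCotangent (p a))
    rw [this, map_add, map_smul, map_smul, smul_eq_mul, smul_eq_mul]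
  have hD1 : D 1 = 0 := by simpa using hD 1 1
  refine ⟨AlgHom.ofLinearMap (LinearMap.prod χ.toLinearMap D) ?_ ?_, fun a ↦ rfl, v, ?_⟩
  · exact TrivSqZeroExt.ext (map_one χ) hD1
  · intro a b
    refine TrivSqZeroExt.ext (map_mul χ a b) ?_
    rw [TrivSqZeroExt.snd_mul]
    change D (a * b) = χ a • D b + MulOpposite.op (χ b) • D a
    rw [hD, smul_eq_mul, op_smul_eq_mul, mul_comm (D a)]
  · have : p v = ⟨v, hv⟩ := Subtype.ext <| by
      rw [hp, RingHom.mem_ker.mp hv, map_zero, sub_zero]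
    change l (q.toCotangent (p v)) ≠ 0
    rwa [this]

variable (K) in
/-- The spectrum of the square-zero extension of `K` by a vector space, as a `K`-scheme. -/
def infinitesimal (M : Type u) [AddCommGroup M] [Module K M] [Module Kᵐᵒᵖ M]
    [IsCentralScalar K M] : Over (Spec (.of K)) :=
  Over.mk (Spec.map (CommRingCat.ofHom (algebraMap K (TrivSqZeroExt K M))))

section

variable {M N P : Type u} [AddCommGroup M] [Module K M] [Module Kᵐᵒᵖ M] [IsCentralScalar K M]
  [AddCommGroup N] [Module K N] [Module Kᵐᵒᵖ N] [IsCentralScalar K N]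
  [AddCommGroup P] [Module K P] [Module Kᵐᵒᵖ P] [IsCentralScalar K P]

/-- The morphism of square-zero extensions induced by a linear map; it is contravariant. -/
def infinitesimalMap (g : M →ₗ[K] N) : infinitesimal K N ⟶ infinitesimal K M :=
  Over.homMk (Spec.map (CommRingCat.ofHom (TrivSqZeroExt.map g).toRingHom)) (by
    change Spec.map _ ≫ Spec.map _ = Spec.map _
    rw [← Spec.map_comp, ← CommRingCat.ofHom_comp]
    congr 2
    exact (TrivSqZeroExt.map g).comp_algebraMap)

@[simp]
lemma infinitesimalMap_id : infinitesimalMap (LinearMap.id : M →ₗ[K] M) = 𝟙 _ := by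
  ext1
  change Spec.map (CommRingCat.ofHom
    (TrivSqZeroExt.map (LinearMap.id : M →ₗ[K] M)).toRingHom) = 𝟙 _
  rw [TrivSqZeroExt.map_id]
  exact Spec.map_id _

lemma infinitesimalMap_comp (f : M →ₗ[K] N) (g : N →ₗ[K] P) :
    infinitesimalMap g ≫ infinitesimalMap f = infinitesimalMap (g ∘ₗ f) := by
  ext1
  change Spec.map _ ≫ Spec.map _ =
    Spec.map (CommRingCat.ofHom (TrivSqZeroExt.map (g ∘ₗ f)).toRingHom)
  rw [← Spec.map_comp, ← CommRingCat.ofHom_comp, TrivSqZeroExt.map_comp_map]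
  rfl

/-- The only prime ideal of a square-zero extension of a field is its nilradical. -/
instance subsingleton_infinitesimal : Subsingleton (infinitesimal K M).left := by
  have h (p : PrimeSpectrum (TrivSqZeroExt K M)) (x : TrivSqZeroExt K M) :
      x ∈ p.asIdeal ↔ IsNilpotent x := by
    refine ⟨fun hx ↦ ?_, fun ⟨n, hn⟩ ↦ p.isPrime.mem_of_pow_mem n (hn ▸ p.asIdeal.zero_mem)⟩
    exact (TrivSqZeroExt.isUnit_or_isNilpotent x).resolve_left fun hu ↦
      p.isPrime.ne_top (p.asIdeal.eq_top_of_isUnit_mem hx hu)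
  exact ⟨fun (p q : PrimeSpectrum (TrivSqZeroExt K M)) ↦
    PrimeSpectrum.ext (Ideal.ext fun x ↦ (h p x).trans (h q x).symm)⟩

end

end TangentVectors

/-! ### The group law on tangent vectors -/

section TangentGroup

variable {E : Over (Spec (.of K))}

variable {M N : Type u} [AddCommGroup M] [Module K M] [Module Kᵐᵒᵖ M] [IsCentralScalar K M]
  [AddCommGroup N] [Module K N] [Module Kᵐᵒᵖ N] [IsCentralScalar K N]

variable {A : CommRingCat.{u}} (j : Spec A ⟶ E.left)

/-- The ring homomorphism `ρ` describes `t` in the affine chart `j`. -/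
def IsCoordinate (t : infinitesimal K M ⟶ E) (ρ : A →+* TrivSqZeroExt K M) : Prop :=
  Spec.map (CommRingCat.ofHom ρ) ≫ j = t.left

variable {j}

lemma IsCoordinate.restrict {t : infinitesimal K M ⟶ E}
    {ρ : A →+* TrivSqZeroExt K M} (h : IsCoordinate j t ρ) (g : M →ₗ[K] N) :
    IsCoordinate j (infinitesimalMap g ≫ t) ((TrivSqZeroExt.map g).toRingHom.comp ρ) := by
  rw [IsCoordinate, Over.comp_left, ← h, CommRingCat.ofHom_comp, Spec.map_comp, Category.assoc]
  rfl

variable [IsOpenImmersion j]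

lemma IsCoordinate.unique {t : infinitesimal K M ⟶ E} {ρ σ : A →+* TrivSqZeroExt K M}
    (hρ : IsCoordinate j t ρ) (hσ : IsCoordinate j t σ) : ρ = σ := by
  have := Spec.map_injective ((cancel_mono j).mp (hρ.trans hσ.symm))
  exact congr($(this).hom)

variable [GrpObj E]

/-- The morphism `t` is a tangent vector at the neutral element: its restriction to the closed
point is the neutral element. The closed point is written as the square-zero extension by the zero
module, so that it is part of the functor `infinitesimal`. -/
def IsTangent (t : infinitesimal K M ⟶ E) : Prop :=
  infinitesimalMap (0 : M →ₗ[K] PUnit.{u + 1}) ≫ t = 1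

lemma IsTangent.restrict {t : infinitesimal K M ⟶ E} (ht : IsTangent t)
    (g : M →ₗ[K] N) : IsTangent (infinitesimalMap g ≫ t) := by
  rw [IsTangent, ← Category.assoc, infinitesimalMap_comp, LinearMap.zero_comp, ht]

lemma IsTangent.restrict_zero {t : infinitesimal K M ⟶ E} (ht : IsTangent t) :
    infinitesimalMap (0 : M →ₗ[K] N) ≫ t = 1 := by
  have : (0 : M →ₗ[K] N) = (0 : PUnit.{u + 1} →ₗ[K] N) ∘ₗ 0 := by simp
  rw [this, ← infinitesimalMap_comp, Category.assoc, ht, MonObj.comp_one]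

lemma IsTangent.mul {t s : infinitesimal K M ⟶ E} (ht : IsTangent t) (hs : IsTangent s) :
    IsTangent (t * s) := by
  rw [IsTangent, MonObj.comp_mul, ht, hs, one_mul]

lemma IsTangent.exists_isCoordinate (hj : ∀ y, η[E].left y ∈ Set.range j)
    {t : infinitesimal K M ⟶ E} (ht : IsTangent t) : ∃ ρ, IsCoordinate j t ρ := by
  have hr (y : (infinitesimal K M).left) : t.left y ∈ Set.range j := by
    have : Nonempty (infinitesimal K PUnit.{u + 1}).left :=
      inferInstanceAs (Nonempty (PrimeSpectrum (TrivSqZeroExt K PUnit.{u + 1})))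
    let y₀ : (infinitesimal K PUnit.{u + 1}).left := Classical.arbitrary _
    rw [Subsingleton.elim y ((infinitesimalMap (0 : M →ₗ[K] PUnit.{u + 1})).left y₀),
      ← Scheme.Hom.comp_apply, ← Over.comp_left, ht, Hom.one_def, Over.comp_left,
      Scheme.Hom.comp_apply]
    exact hj _
  refine ⟨(Spec.preimage (IsOpenImmersion.lift j t.left (Set.range_subset_iff.mpr hr))).hom, ?_⟩
  rw [IsCoordinate, CommRingCat.ofHom_hom, Spec.map_preimage]
  exact IsOpenImmersion.lift_fac _ _ _

/-- The group law induces addition of tangent vectors: the product `t * s` is the restriction to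
the diagonal of the infinitesimal morphism to `E` with components `t` and `s`. -/
lemma IsCoordinate.mul (hj : ∀ y, η[E].left y ∈ Set.range j) {t s : infinitesimal K M ⟶ E}
    {ρ σ : A →+* TrivSqZeroExt K M} (ht : IsTangent t) (hs : IsTangent s)
    (hρ : IsCoordinate j t ρ) (hσ : IsCoordinate j s σ) :
    ∃ τ, IsCoordinate j (t * s) τ ∧ ∀ a, (τ a).snd = (ρ a).snd + (σ a).snd := by
  let w : infinitesimal K (M × M) ⟶ E :=
    (infinitesimalMap (.inl K M M) ≫ t) * (infinitesimalMap (.inr K M M) ≫ s)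
  have hw : IsTangent w := (ht.restrict _).mul (hs.restrict _)
  obtain ⟨τ, hτ⟩ := hw.exists_isCoordinate hj
  have h1 : infinitesimalMap (.fst K M M) ≫ w = t := by
    rw [MonObj.comp_mul, ← Category.assoc, ← Category.assoc, infinitesimalMap_comp,
      infinitesimalMap_comp, LinearMap.fst_comp_inl, LinearMap.fst_comp_inr,
      hs.restrict_zero, infinitesimalMap_id, Category.id_comp, mul_one]
  have h2 : infinitesimalMap (.snd K M M) ≫ w = s := by
    rw [MonObj.comp_mul, ← Category.assoc, ← Category.assoc, infinitesimalMap_comp,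
      infinitesimalMap_comp, LinearMap.snd_comp_inl, LinearMap.snd_comp_inr,
      ht.restrict_zero, infinitesimalMap_id, Category.id_comp, one_mul]
  have h3 : infinitesimalMap (.coprod .id .id) ≫ w = t * s := by
    rw [MonObj.comp_mul, ← Category.assoc, ← Category.assoc, infinitesimalMap_comp,
      infinitesimalMap_comp, LinearMap.coprod_inl, LinearMap.coprod_inr,
      infinitesimalMap_id, Category.id_comp, Category.id_comp]
  have hτ1 := hτ.restrict (.fst K M M)
  have hτ2 := hτ.restrict (.snd K M M)
  have hτ3 := hτ.restrict (.coprod .id .id)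
  rw [h1] at hτ1
  rw [h2] at hτ2
  rw [h3] at hτ3
  refine ⟨_, hτ3, fun a ↦ ?_⟩
  rw [hρ.unique hτ1, hσ.unique hτ2]
  change (TrivSqZeroExt.map _ (τ a)).snd =
    (TrivSqZeroExt.map _ (τ a)).snd + (TrivSqZeroExt.map _ (τ a)).snd
  simp

lemma IsCoordinate.pow (hj : ∀ y, η[E].left y ∈ Set.range j) {t : infinitesimal K M ⟶ E}
    {ρ : A →+* TrivSqZeroExt K M} (ht : IsTangent t) (hρ : IsCoordinate j t ρ) (n : ℕ) :
    IsTangent (t ^ n) ∧ ∃ τ, IsCoordinate j (t ^ n) τ ∧ ∀ a, (τ a).snd = n • (ρ a).snd := by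
  induction n with
  | zero =>
    have h0 := hρ.restrict (0 : M →ₗ[K] M)
    rw [ht.restrict_zero] at h0
    refine ⟨by rw [pow_zero, IsTangent, MonObj.comp_one], _, by rwa [pow_zero], fun a ↦ ?_⟩
    change (TrivSqZeroExt.map _ (ρ a)).snd = _
    simp
  | succ n ih =>
    obtain ⟨htn, τ, hτ, h⟩ := ih
    obtain ⟨τ', hτ', h'⟩ := hτ.mul hj htn ht hρ
    rw [pow_succ]
    exact ⟨htn.mul ht, τ', hτ', fun a ↦ by rw [h', h, succ_nsmul]⟩

end TangentGroup

/-! ### Multiplication by an integer -/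

section Multiplication

lemma SpecMap_constantSections (X : Over (Spec (.of K))) {U : X.left.Opens} (hU : IsAffineOpen U) :
    Spec.map (CommRingCat.ofHom (constantSections X U)) = hU.fromSpec ≫ X.hom := by
  rw [← (isAffineOpen_top (Spec (.of K))).SpecMap_appLE_fromSpec X.hom hU le_top,
    IsAffineOpen.fromSpec_top, Scheme.isoSpec_Spec_inv, ← Spec.map_comp]
  rfl

/-- The ideal of a rational point in an affine open set of a curve is not idempotent: otherwise it
would be zero, and the function field would be `K`. -/
lemma not_isIdempotentElem_ker (X : Over (Spec (.of K))) [IsCurve X] {U : X.left.Opens}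
    (hU : IsAffineOpen U) [Nonempty U] (χ : Γ(X.left, U) →+* K)
    (hχ : χ.comp (constantSections X U) = RingHom.id K) :
    ¬ IsIdempotentElem (RingHom.ker χ) := fun hid ↦ by
  have := LocallyOfFiniteType.isLocallyNoetherian X.hom
  have : IsNoetherianRing Γ(X.left, U) := IsLocallyNoetherian.component_noetherian ⟨U, hU⟩
  have hbot := ((Ideal.isIdempotentElem_iff_eq_bot_or_top _ (IsNoetherian.noetherian _)).mp
    hid).resolve_right (RingHom.ker_ne_top χ)
  have hinj := (RingHom.injective_iff_ker_eq_bot χ).mpr hbot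
  have hsurj (a : Γ(X.left, U)) : constantSections X U (χ a) = a :=
    hinj congr($hχ (χ a))
  have : IsFractionRing Γ(X.left, U) X.left.functionField :=
    functionField_isFractionRing_of_isAffineOpen _ U hU
  have : Algebra.IsAlgebraic K X.left.functionField := ⟨fun z ↦ by
    obtain ⟨a, b, -, rfl⟩ := IsFractionRing.div_surjective (A := Γ(X.left, U)) z
    rw [← hsurj a, ← hsurj b]
    have h (c : K) : algebraMap Γ(X.left, U) X.left.functionField (constantSections X U c) =
        algebraMap K _ c := by
      rw [algebraMap_functionField_eq X U, RingHom.comp_apply]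
    rw [h, h, ← map_div₀]
    exact isAlgebraic_algebraMap _⟩
  have h1 := trdeg_functionField X
  rw [trdeg_eq_zero (R := K)] at h1
  exact zero_ne_one h1

/-- Multiplication by `n` on a one-dimensional group is not zero in characteristic zero, because it
is multiplication by `n` on the tangent space. -/
lemma id_pow_ne_one [CharZero K] (E : Over (Spec (.of K))) [IsCurve E] [GrpObj E] {n : ℕ}
    (hn : n ≠ 0) : (𝟙 E) ^ n ≠ 1 := fun hpow ↦ by
  have : Subsingleton (𝟙_ (Over (Spec (.of K)))).left :=
    inferInstanceAs (Subsingleton (PrimeSpectrum K))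
  let pt : (𝟙_ (Over (Spec (.of K)))).left := IsLocalRing.closedPoint K
  obtain ⟨_, ⟨U, hU, rfl⟩, hxU, -⟩ := E.left.isBasis_affineOpens.exists_subset_of_mem_open
    (Set.mem_univ (η[E].left pt)) isOpen_univ
  have hU : IsAffineOpen U := hU
  have : Nonempty U := ⟨⟨_, hxU⟩⟩
  have hj (y) : η[E].left y ∈ Set.range hU.fromSpec := by
    rw [hU.range_fromSpec, Subsingleton.elim y pt]
    exact hxU
  let : Algebra K Γ(E.left, U) := (constantSections E U).toAlgebra
  -- the coordinates of the neutral element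
  have hone : IsTangent (1 : infinitesimal K K ⟶ E) := MonObj.comp_one _
  obtain ⟨ρ₀, hρ₀⟩ := hone.exists_isCoordinate hj
  have hρ₀K : ρ₀.comp (constantSections E U) = algebraMap K (TrivSqZeroExt K K) := by
    have h : Spec.map (CommRingCat.ofHom (ρ₀.comp (constantSections E U))) =
        (infinitesimal K K).hom := by
      rw [CommRingCat.ofHom_comp, Spec.map_comp, SpecMap_constantSections E hU, ← Category.assoc,
        hρ₀]
      exact Over.w _
    exact congr($(Spec.map_injective h).hom)
  let χ : Γ(E.left, U) →ₐ[K] K := (TrivSqZeroExt.fstHom K K K).comp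
    { ρ₀ with commutes' := fun c ↦ congr($hρ₀K c) }
  obtain ⟨ρ, hρχ, a, ha⟩ := exists_algHom_dualNumber χ
    (not_isIdempotentElem_ker E hU χ.toRingHom χ.comp_algebraMap)
  let t : infinitesimal K K ⟶ E :=
    Over.homMk (Spec.map (CommRingCat.ofHom ρ.toRingHom) ≫ hU.fromSpec) <| by
      refine (Category.assoc _ _ _).trans ?_
      rw [← SpecMap_constantSections E hU]
      refine (Spec.map_comp _ _).symm.trans ?_
      exact congr(Spec.map (CommRingCat.ofHom $(ρ.comp_algebraMap)))
  have htρ : IsCoordinate hU.fromSpec t ρ.toRingHom := rfl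
  have ht : IsTangent t := by
    have h0 := hρ₀.restrict (0 : K →ₗ[K] PUnit.{u + 1})
    rw [MonObj.comp_one] at h0
    have h1 := htρ.restrict (0 : K →ₗ[K] PUnit.{u + 1})
    rw [IsTangent]
    ext1
    rw [← h0, ← h1]
    congr 3
    ext b
    change (TrivSqZeroExt.map _ (ρ b)).fst = (TrivSqZeroExt.map _ (ρ₀ b)).fst
    rw [TrivSqZeroExt.fst_map, TrivSqZeroExt.fst_map]
    exact hρχ b
  -- compare the coordinates of `t ^ n` and of `t ^ 0`, which are equal morphisms
  obtain ⟨-, τ, hτ, hτn⟩ := htρ.pow hj ht n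
  obtain ⟨-, τ₀, hτ₀, hτ₀n⟩ := htρ.pow hj ht 0
  have htn : t ^ n = t ^ 0 := by
    have := MonObj.comp_pow (𝟙 E) n t
    rw [Category.comp_id, hpow, MonObj.comp_one] at this
    rw [← this, pow_zero]
  rw [htn] at hτ
  have := hτn a
  rw [hτ.unique hτ₀, hτ₀n a, zero_smul, eq_comm, smul_eq_zero] at this
  exact this.elim hn ha

end Multiplication

/-! ### Invariant morphisms and the quotient map -/

section Invariants

/-- The automorphisms which leave the morphism `ψ` invariant. -/
def invariantSubgroup {X Z : Over (Spec (.of K))} (ψ : X ⟶ Z) : Subgroup (Aut X) where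
  carrier := {g | g.hom ≫ ψ = ψ}
  one_mem' := Category.id_comp ψ
  mul_mem' {g h} (hg : g.hom ≫ ψ = ψ) (hh : h.hom ≫ ψ = ψ) := by
    change (h.hom ≫ g.hom) ≫ ψ = ψ
    rw [Category.assoc, hg, hh]
  inv_mem' {g} (hg : g.hom ≫ ψ = ψ) := by
    change g.inv ≫ ψ = ψ
    exact (Iso.inv_comp_eq (g : X ≅ X)).mpr hg.symm

lemma mem_invariantSubgroup {X Z : Over (Spec (.of K))} {ψ : X ⟶ Z} {g : Aut X} :
    g ∈ invariantSubgroup ψ ↔ g.hom ≫ ψ = ψ := Iff.rfl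

variable {X E : Over (Spec (.of K))}

lemma conjPow_le_invariantSubgroup {H : Subgroup (Aut X)} {f : X ⟶ E} (hf : IsQuotient H f)
    (σ : Aut X) (i : ℕ) : conjPow H σ i ≤ invariantSubgroup (precomp f (σ ^ i)) := by
  rintro _ ⟨h, hh, rfl⟩
  have key : σ ^ i * ((σ ^ i)⁻¹ * h * (σ ^ i)) = h * σ ^ i := by group
  have key' : ((σ ^ i)⁻¹ * h * (σ ^ i)).hom ≫ (σ ^ i).hom = (σ ^ i).hom ≫ h.hom :=
    congr(($key).hom)
  change ((σ ^ i)⁻¹ * h * (σ ^ i)⁻¹⁻¹).hom ≫ (σ ^ i).hom ≫ f = (σ ^ i).hom ≫ f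
  rw [inv_inv, ← Category.assoc, key', Category.assoc, hf.1 h hh]

variable [GrpObj E] [IsEllipticCurve E]

lemma hom_comp_prod {Z : Over (Spec (.of K))} (g : Z ⟶ X) {I : Type*} (s : Finset I)
    (F : I → (X ⟶ E)) : g ≫ ∏ i ∈ s, F i = ∏ i ∈ s, g ≫ F i :=
  map_prod (⟨⟨fun φ ↦ g ≫ φ, MonObj.comp_one g⟩, MonObj.comp_mul g⟩ : (X ⟶ E) →* (Z ⟶ E)) F s

/-- No positive power of the quotient map `f : X ⟶ E` is invariant under a group of automorphisms
with quotient of genus zero. -/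
lemma not_le_invariantSubgroup_pow [CharZero K] {G H : Subgroup (Aut X)} {f : X ⟶ E}
    (hf : IsQuotient H f) (hG : QuotientHasGenusZero G) {n : ℕ} (hn : n ≠ 0) :
    ¬ G ≤ invariantSubgroup (f ^ n) := fun hle ↦ by
  obtain ⟨Y, hY, π, hπ, hg⟩ := hG
  obtain ⟨φ, hφ, -⟩ := hπ.2 E (f ^ n) fun g hg ↦ hle hg
  exact id_pow_ne_one E hn (pow_eq_one_of_factors hf hg n π φ hφ.symm)

/-- The sum of the conjugates is not constant: otherwise `f` is a constant minus the sum of the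
other conjugates, hence invariant under the group with quotient of genus zero. -/
lemma not_isConstant_orbitSum [CharZero K] {H : Subgroup (Aut X)} {f : X ⟶ E}
    (hf : IsQuotient H f) (σ : Aut X) {n : ℕ} (hn : 1 ≤ n)
    (h0 : QuotientHasGenusZero (H ⊔ ⨅ i ∈ Finset.Icc 1 (n - 1), conjPow H σ i)) :
    ¬ IsConstant (orbitSum f σ n) := by
  rintro ⟨c, hc⟩
  obtain ⟨m, rfl⟩ := Nat.exists_eq_add_of_le' hn
  refine not_le_invariantSubgroup_pow hf h0 one_ne_zero ?_
  rw [pow_one]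
  refine sup_le (fun g hg ↦ hf.1 g hg) fun g hg ↦ ?_
  have hf' : f = (toUnit X ≫ c) / ∏ i ∈ Finset.range m, precomp f (σ ^ (i + 1)) := by
    rw [← hc, orbitSum, Finset.prod_range_succ', mul_div_cancel_left]
    exact (Category.id_comp f).symm
  have hg' (i) (hi : i ∈ Finset.range m) :
      g.hom ≫ precomp f (σ ^ (i + 1)) = precomp f (σ ^ (i + 1)) := by
    refine conjPow_le_invariantSubgroup hf σ (i + 1) ?_
    simp only [Subgroup.mem_iInf] at hg
    refine hg (i + 1) (Finset.mem_Icc.mpr ⟨by omega, ?_⟩)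
    have := Finset.mem_range.mp hi
    omega
  rw [mem_invariantSubgroup, hf', GrpObj.comp_div, hom_comp_prod, Finset.prod_congr rfl hg',
    ← Category.assoc, toUnit_unique (g.hom ≫ toUnit X) (toUnit X)]

/-- The difference is not constant: otherwise the constant is torsion, and a multiple of `f` is
invariant under the group with quotient of genus zero. -/
lemma not_isConstant_orbitDiff [CharZero K] {H : Subgroup (Aut X)} {f : X ⟶ E}
    (hf : IsQuotient H f) {σ : Aut X} (hσ : IsOfFinOrder σ)
    (h0 : QuotientHasGenusZero (Subgroup.zpowers σ ⊔ H)) :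
    ¬ IsConstant (orbitDiff f σ) := by
  rintro ⟨c, hc⟩
  let C : X ⟶ E := toUnit X ≫ c
  have hC : σ.hom ≫ C = C := by
    rw [← Category.assoc, toUnit_unique (σ.hom ≫ toUnit X) (toUnit X)]
  have hfσ : σ.hom ≫ f = f / C := by
    rw [show C = f / (σ.hom ≫ f) from hc.symm, div_div_cancel]
  have hfσk (k : ℕ) : (σ ^ k).hom ≫ f = f / C ^ k := by
    induction k with
    | zero => rw [pow_zero, pow_zero, div_one]; exact Category.id_comp f
    | succ k ih =>
      have : (σ ^ (k + 1)).hom = σ.hom ≫ (σ ^ k).hom := by rw [pow_succ]; rfl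
      rw [this, Category.assoc, ih, GrpObj.comp_div, MonObj.comp_pow, hC, hfσ, pow_succ', div_div]
  have hCN : C ^ orderOf σ = 1 := by
    have := hfσk (orderOf σ)
    rw [pow_orderOf_eq_one] at this
    have := (Category.id_comp f).symm.trans this
    exact div_eq_self.mp this.symm
  refine not_le_invariantSubgroup_pow hf h0 hσ.orderOf_pos.ne' (sup_le ?_ fun g hg ↦ ?_)
  · rw [Subgroup.zpowers_le, mem_invariantSubgroup, MonObj.comp_pow, hfσ, div_pow, hCN, div_one]
  · rw [mem_invariantSubgroup, MonObj.comp_pow, hf.1 g hg]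

end Invariants

end QuotientCurve

end

theorem proposition5p1 {K : Type u} [Field K] [NumberField K]
    (X : Over (Spec (.of K))) [QuotientCurve.IsCurve X]
    (G H : Subgroup (Aut X)) (hG : Finite G) (hH : Finite H)
    (E : Over (Spec (.of K))) [GrpObj E] [QuotientCurve.IsEllipticCurve E]
    (f : X ⟶ E) (hf : QuotientCurve.IsQuotient H f) (σ : Aut X) (hσ : σ ∈ G) :
    (∀ n : ℕ, 1 ≤ n →
      QuotientCurve.QuotientHasGenusZero
        (H ⊔ ⨅ i ∈ Finset.Icc 1 (n - 1), QuotientCurve.conjPow H σ i) →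
      ¬ QuotientCurve.IsConstant (QuotientCurve.orbitSum f σ n)) ∧
    (QuotientCurve.QuotientHasGenusZero (Subgroup.zpowers σ ⊔ H) →
      ¬ QuotientCurve.IsConstant (QuotientCurve.orbitDiff f σ)) := by
  have hfin : IsOfFinOrder σ :=
    (Submonoid.isOfFinOrder_coe (H := G.toSubmonoid) (x := ⟨σ, hσ⟩)).mpr
      (isOfFinOrder_of_finite (⟨σ, hσ⟩ : G))
  exact ⟨fun n hn ↦ QuotientCurve.not_isConstant_orbitSum hf σ hn,
    QuotientCurve.not_isConstant_orbitDiff hf hfin⟩
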